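/- A hypergraph $\mathcal{C}$ on a finite (possibly empty) vertex set $V$ is a family of pairwise incomparable subsets of $V$ (its edges), each of cardinality at least $2$; $\mathcal{C}$ is identified with its set of edges. Its independence complex $\operatorname{Ind}(\mathcal{C})$ is the simplicial complex on $V$ whose faces are the subsets of $V$ that contain no edge of $\mathcal{C}$. For an edge $F$ of $\mathcal{C}$, let $\mathcal{C}-F$ be the hypergraph on $V$ obtained by removing the edge $F$, and let $\mathcal{C}:F$ be the hypergraph on $V\setminus (F\cup N_{\mathcal{C}}(F))$ whose edges are those inclusion-minimal members of $\{E\setminus F : E \text{ an edge of } \mathcal{C}-F\}$ that have cardinality at least $2$, where $N_{\mathcal{C}}(F)=\bigcup\{E\setminus F : E\in\mathcal{C},\ |E\setminus F|=1\}$. The number $\psi(\mathcal{C})\in\{0,1,2,\dots\}\cup\{\infty\}$ is defined recursively by $$\psi(\mathcal{C})=\begin{cases}0, & V=\emptyset,\\ \infty, & V\neq\emptyset \text{ and } \mathcal{C}=\emptyset,\\ \max_{F\in\mathcal{C}}\min\{\psi(\mathcal{C}-F),\ \psi(\mathcal{C}:F)+|F|-1\}, & \text{otherwise.}\end{cases}$$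 The homological connectivity $\operatorname{conn_h}(\Delta)$ of a simplicial complex $\Delta$ is the greatest integer $k$ such that the reduced homology groups with integer coefficients satisfy $\tilde H_i(\Delta)=0$ for all $-1\le i\le k$, and $\operatorname{conn_h}(\Delta)=\infty$ if $\tilde H_i(\Delta)=0$ for all $i$; in particular the complex with no vertices has homological connectivity $-2$. A hypergraph $\mathcal{C}$ is called properly-splitted if either $\mathcal{C}=\emptyset$ (there are no edges), or $\mathcal{C}$ has an edge $F$ with $\operatorname{conn_h}(\operatorname{Ind}(\mathcal{C}:F))\ge \operatorname{conn_h}(\operatorname{Ind}(\mathcal{C}))-|F|+1$ such that both $\mathcal{C}-F$ and $\mathcal{C}:F$ are properly-splitted. Theorem. If $\mathcal{C}$ is a properly-splitted hypergraph, then $\psi(\mathcal{C})=\operatorname{conn_h}(\operatorname{Ind}(\mathcal{C}))+2$. -/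

import Mathlib

/-- A hypergraph on a finite vertex set: a family of pairwise incomparable subsets of the
vertex set (the edges), each of cardinality at least `2`. -/
@[ext]
structure SimpleHypergraph (α : Type*) where
  /-- the vertex set -/
  verts : Finset α
  /-- the set of edges -/
  edges : Finset (Finset α)
  subset_verts : ∀ E ∈ edges, E ⊆ verts
  incomparable : ∀ E ∈ edges, ∀ E' ∈ edges, E ⊆ E' → E = E'
  two_le_card : ∀ E ∈ edges, 2 ≤ E.card

namespace SimpleHypergraph

section Operations

variable {α : Type*} [DecidableEq α]

/-- The hypergraph `C - F`: remove the edge `F`, keep all the vertices. -/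
def deleteEdge (C : SimpleHypergraph α) (F : Finset α) : SimpleHypergraph α where
  verts := C.verts
  edges := C.edges.erase F
  subset_verts E hE := C.subset_verts E (Finset.mem_of_mem_erase hE)
  incomparable E hE E' hE' h :=
    C.incomparable E (Finset.mem_of_mem_erase hE) E' (Finset.mem_of_mem_erase hE') h
  two_le_card E hE := C.two_le_card E (Finset.mem_of_mem_erase hE)

/-- The vertex neighbour set of `F`: the union of the sets `E \ F` over all the edges `E`
with `|E \ F| = 1`. -/
def edgeNeighbours (C : SimpleHypergraph α) (F : Finset α) : Finset α :=
  (C.edges.filter fun E => (E \ F).card = 1).biUnion fun E => E \ F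

/-- The family of the sets `E \ F`, where `E` is an edge of `C - F`. -/
def traces (C : SimpleHypergraph α) (F : Finset α) : Finset (Finset α) :=
  (C.edges.erase F).image fun E => E \ F

/-- The hypergraph `C : F` on the vertex set `V \ (F ∪ N(F))`: its edges are those (inclusion-wise)
minimal members of the family `{E \ F | E an edge of C - F}` that have cardinality at least `2`. -/
def colon (C : SimpleHypergraph α) (F : Finset α) : SimpleHypergraph α where
  verts := C.verts \ (F ∪ C.edgeNeighbours F)
  edges := (C.traces F).filter fun S => 2 ≤ S.card ∧ ∀ T ∈ C.traces F, T ⊆ S → T = S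
  subset_verts := by
    intro S hS x hx
    obtain ⟨hS, h2, hmin⟩ := Finset.mem_filter.1 hS
    obtain ⟨E, hE, rfl⟩ := Finset.mem_image.1 hS
    have hEC := Finset.mem_of_mem_erase hE
    obtain ⟨hxE, hxF⟩ := Finset.mem_sdiff.1 hx
    refine Finset.mem_sdiff.2 ⟨C.subset_verts E hEC hxE, fun h => ?_⟩
    rcases Finset.mem_union.1 h with h | h
    · exact hxF h
    · obtain ⟨E', hE', hx'⟩ := Finset.mem_biUnion.1 h
      obtain ⟨hE'C, h1⟩ := Finset.mem_filter.1 hE'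
      have hne : E' ≠ F := by
        rintro rfl
        simp at h1
      have hsub : E' \ F ⊆ E \ F := by
        obtain ⟨y, hy⟩ := Finset.card_eq_one.1 h1
        rw [hy] at hx' ⊢
        rw [Finset.mem_singleton.1 hx'] at hx
        exact Finset.singleton_subset_iff.2 hx
      have heq := hmin (E' \ F)
        (Finset.mem_image.2 ⟨E', Finset.mem_erase.2 ⟨hne, hE'C⟩, rfl⟩) hsub
      rw [← heq, h1] at h2
      omega
  incomparable S hS T hT h :=
    (Finset.mem_filter.1 hT).2.2 S (Finset.mem_filter.1 hS).1 h
  two_le_card S hS := (Finset.mem_filter.1 hS).2.1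

theorem card_edges_deleteEdge_lt (C : SimpleHypergraph α) {F : Finset α} (hF : F ∈ C.edges) :
    (C.deleteEdge F).edges.card < C.edges.card :=
  Finset.card_erase_lt_of_mem hF

theorem card_edges_colon_lt (C : SimpleHypergraph α) {F : Finset α} (hF : F ∈ C.edges) :
    (C.colon F).edges.card < C.edges.card :=
  lt_of_le_of_lt ((Finset.card_filter_le _ _).trans Finset.card_image_le)
    (Finset.card_erase_lt_of_mem hF)

/-- The recursively defined number `ψ(C) ∈ {0, 1, 2, …} ∪ {∞}`: it is `0` if `V = ∅`, it is `∞`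
if `V ≠ ∅` and there are no edges, and otherwise it is the maximum over the edges `F` of
`min {ψ(C - F), ψ(C : F) + |F| - 1}`. -/
noncomputable def psi (C : SimpleHypergraph α) : ℕ∞ :=
  if C.verts = ∅ then 0
  else if C.edges = ∅ then ⊤
  else C.edges.attach.sup fun F =>
    min (psi (C.deleteEdge F.1)) (psi (C.colon F.1) + ((F.1.card - 1 : ℕ) : ℕ∞))
termination_by C.edges.card
decreasing_by
  · exact C.card_edges_deleteEdge_lt F.2
  · exact C.card_edges_colon_lt F.2

end Operations

/-- The independence complex `Ind(C)`: its faces are the sets of vertices that contain no edge.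
(As always for `PreAbstractSimplicialComplex`, only the nonempty faces are listed.) -/
def Ind {α : Type*} (C : SimpleHypergraph α) : PreAbstractSimplicialComplex α where
  faces := {σ | σ.Nonempty ∧ σ ⊆ C.verts ∧ ∀ E ∈ C.edges, ¬ E ⊆ σ}
  isRelLowerSet_faces := fun _ h =>
    ⟨h.1, fun _ hts ht => ⟨ht, hts.trans h.2.1, fun E hE hEt => h.2.2 E hE (hEt.trans hts)⟩⟩

end SimpleHypergraph

namespace PreAbstractSimplicialComplex

variable {α : Type*} [LinearOrder α]

/-- The simplicial boundary map. The simplices are oriented by the linear order of the vertices,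
and the boundary of the simplex `v₀ < v₁ < … < vₙ` is `∑ i, (-1)ⁱ [v₀, …, v̂ᵢ, …, vₙ]`.
The boundary of a vertex is the empty simplex, so this includes the augmentation. -/
noncomputable def boundary (α : Type*) [LinearOrder α] :
    (Finset α →₀ ℤ) →ₗ[ℤ] (Finset α →₀ ℤ) :=
  Finsupp.linearCombination ℤ fun σ : Finset α =>
    ∑ v ∈ σ, Finsupp.single (σ.erase v) ((-1 : ℤ) ^ (σ.filter fun u => u < v).card)

/-- The augmented oriented simplicial chains of degree `i : ℤ` with integer coefficients:
formal integer combinations of the faces with `i + 1` vertices, where the empty set counts as the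
face of dimension `-1`. -/
noncomputable def augChains (K : PreAbstractSimplicialComplex α) (i : ℤ) :
    Submodule ℤ (Finset α →₀ ℤ) :=
  Finsupp.supported ℤ ℤ {σ | (σ = ∅ ∨ σ ∈ K.faces) ∧ (σ.card : ℤ) = i + 1}

/-- The reduced cycles of degree `i`. -/
noncomputable def augCycles (K : PreAbstractSimplicialComplex α) (i : ℤ) :
    Submodule ℤ (Finset α →₀ ℤ) :=
  K.augChains i ⊓ LinearMap.ker (boundary α)

/-- The reduced boundaries of degree `i`. -/
noncomputable def augBoundaries (K : PreAbstractSimplicialComplex α) (i : ℤ) :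
    Submodule ℤ (Finset α →₀ ℤ) :=
  (K.augChains (i + 1)).map (boundary α)

theorem boundary_single (σ : Finset α) (n : ℤ) :
    boundary α (Finsupp.single σ n) =
      n • ∑ v ∈ σ, Finsupp.single (σ.erase v) ((-1 : ℤ) ^ (σ.filter fun u => u < v).card) := by
  simp only [boundary, Finsupp.linearCombination_single]

theorem sign_swap (σ : Finset α) {v w : α} (hv : v ∈ σ) (hvw : v < w) :
    (-1 : ℤ) ^ (σ.filter fun u => u < v).card *
        (-1 : ℤ) ^ ((σ.erase v).filter fun u => u < w).card +
      (-1 : ℤ) ^ (σ.filter fun u => u < w).card *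
        (-1 : ℤ) ^ ((σ.erase w).filter fun u => u < v).card = 0 := by
  have h1 : (σ.erase w).filter (fun u => u < v) = σ.filter fun u => u < v := by
    ext u
    simp only [Finset.mem_filter, Finset.mem_erase]
    exact ⟨fun h => ⟨h.1.2, h.2⟩, fun h => ⟨⟨(h.2.trans hvw).ne, h.1⟩, h.2⟩⟩
  have h2 : ((σ.erase v).filter fun u => u < w).card + 1 = (σ.filter fun u => u < w).card := by
    rw [Finset.filter_erase]
    exact Finset.card_erase_add_one (Finset.mem_filter.2 ⟨hv, hvw⟩)
  rw [h1, ← h2, pow_succ]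
  ring

theorem boundary_boundary (c : Finset α →₀ ℤ) : boundary α (boundary α c) = 0 := by
  induction c using Finsupp.induction_linear with
  | zero => simp
  | add f g hf hg => rw [map_add, map_add, hf, hg, add_zero]
  | single σ n =>
    rw [boundary_single, map_smul, map_sum]
    simp only [boundary_single, Finset.smul_sum, Finsupp.smul_single, smul_eq_mul]
    rw [Finset.sum_sigma']
    refine Finset.sum_involution (fun p _ => ⟨p.2, p.1⟩) ?_ ?_ ?_ ?_
    · rintro ⟨v, w⟩ h
      obtain ⟨hv, hw⟩ := Finset.mem_sigma.1 h
      obtain ⟨hwv, hw⟩ := Finset.mem_erase.1 hw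
      simp only at hv hw hwv ⊢
      rw [Finset.erase_right_comm (a := w) (b := v), ← Finsupp.single_add, ← mul_add]
      rcases lt_or_gt_of_ne hwv with h | h
      · rw [add_comm, sign_swap σ hw h, mul_zero, Finsupp.single_zero]
      · rw [sign_swap σ hv h, mul_zero, Finsupp.single_zero]
    · rintro ⟨v, w⟩ h _ he
      have := (Finset.mem_erase.1 (Finset.mem_sigma.1 h).2).1
      simp only [Sigma.mk.injEq] at he
      exact this he.1
    · rintro ⟨v, w⟩ h
      obtain ⟨hv, hw⟩ := Finset.mem_sigma.1 h
      obtain ⟨hwv, hw⟩ := Finset.mem_erase.1 hw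
      exact Finset.mem_sigma.2 ⟨hw, Finset.mem_erase.2 ⟨hwv.symm, hv⟩⟩
    · rintro ⟨v, w⟩ _
      rfl

theorem boundary_mem_augChains (K : PreAbstractSimplicialComplex α) {i : ℤ} {c : Finset α →₀ ℤ}
    (hc : c ∈ K.augChains (i + 1)) : boundary α c ∈ K.augChains i := by
  rw [boundary, Finsupp.linearCombination_apply]
  refine Submodule.sum_mem _ fun σ hσ => Submodule.smul_mem _ _ (Submodule.sum_mem _ fun v hv => ?_)
  obtain ⟨hK, hcard⟩ := hc hσ
  refine Finsupp.single_mem_supported ℤ _ ⟨?_, ?_⟩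
  · rcases hK with rfl | hK
    · simp at hv
    · rcases (σ.erase v).eq_empty_or_nonempty with h | h
      · exact Or.inl h
      · exact Or.inr ((K.isRelLowerSet_faces hK).2 (Finset.erase_subset v σ) h)
  · have := Finset.card_erase_add_one hv
    omega

theorem augBoundaries_le_augCycles (K : PreAbstractSimplicialComplex α) (i : ℤ) :
    K.augBoundaries i ≤ K.augCycles i := by
  rintro _ ⟨c, hc, rfl⟩
  exact ⟨K.boundary_mem_augChains hc, LinearMap.mem_ker.2 (boundary_boundary c)⟩

/-- The reduced homology group of degree `i` with integer coefficients: cycles modulo boundaries. -/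
abbrev ReducedHomology (K : PreAbstractSimplicialComplex α) (i : ℤ) : Type _ :=
  K.augCycles i ⧸ (K.augBoundaries i).submoduleOf (K.augCycles i)

open Classical in
/-- The homological connectivity: `∞` if all the reduced homology groups vanish, and otherwise the
greatest integer `k` such that the reduced homology groups of degree `i` vanish for all
`-1 ≤ i ≤ k`. (All `k ≤ -2` have the property, and the set of such `k` is then bounded above.) -/
noncomputable def connH (K : PreAbstractSimplicialComplex α) : WithTop ℤ :=
  if ∀ i : ℤ, Subsingleton (K.ReducedHomology i) then ⊤
  else ((sSup {k : ℤ | ∀ i : ℤ, -1 ≤ i → i ≤ k → Subsingleton (K.ReducedHomology i)} : ℤ) :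
    WithTop ℤ)

end PreAbstractSimplicialComplex

namespace SimpleHypergraph

/-- Properly-splitted hypergraphs: either there are no edges, or there is an edge `F` with
`conn_h(Ind(C : F)) ≥ conn_h(Ind(C)) - |F| + 1` such that both `C - F` and `C : F` are
properly-splitted. -/
inductive IsProperlySplitted {α : Type*} [LinearOrder α] : SimpleHypergraph α → Prop
  | of_edges_eq_empty (C : SimpleHypergraph α) (h : C.edges = ∅) : IsProperlySplitted C
  | of_edge (C : SimpleHypergraph α) (F : Finset α) (hF : F ∈ C.edges)
      (hconn : C.Ind.connH + ((-(F.card : ℤ) + 1 : ℤ) : WithTop ℤ) ≤ (C.colon F).Ind.connH)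
      (hdelete : IsProperlySplitted (C.deleteEdge F))
      (hcolon : IsProperlySplitted (C.colon F)) : IsProperlySplitted C

end SimpleHypergraph

/-! ### Vanishing of reduced homology and connectivity -/

namespace PreAbstractSimplicialComplex

/-! Removing an edge F enlarges Ind(C) to Ind(C - F) by exactly the simplices containing F, and the
link of F in Ind(C - F) is Ind(C : F). The quotient of the augmented chain complexes is therefore
that of Ind(C : F) shifted by |F|, which gives the exact sequence H_{i+1-|F|}(C : F) → H_i(C) →
H_i(C - F) → H_{i-|F|}(C : F).

The left half (`IsStarExtension.acyclicAt`), by induction on the number of edges, gives ψ ≤ conn_h +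
2 for every hypergraph. For the converse, the splitting inequality makes the right-hand term vanish
for i ≤ conn_h(Ind(C)), so Ind(C - F) is at least as connected as Ind(C) (`acyclicAt_extension`); by
induction the splitting edge itself witnesses the lower bound on the maximum defining ψ. Without
edges, Ind(C) is a full simplex or has no vertices.

Both bounds are proved as statements "n ≤ ψ" versus "n - 2 ≤ conn_h" for natural n, which avoids
arithmetic with infinite values. -/

theorem mem_augChains_iff {α : Type*} (K : PreAbstractSimplicialComplex α) {i : ℤ}
    {c : Finset α →₀ ℤ} :
    c ∈ K.augChains i ↔
      ∀ σ, c σ ≠ 0 → (σ = ∅ ∨ σ ∈ K.faces) ∧ (σ.card : ℤ) = i + 1 := by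
  rw [augChains, Finsupp.mem_supported]
  exact ⟨fun h σ hσ => h (Finsupp.mem_support_iff.2 hσ),
    fun h σ hσ => h σ (Finsupp.mem_support_iff.1 hσ)⟩

variable {α : Type*} [LinearOrder α]

/-- The reduced homology of `K` in degree `i` vanishes: every cycle is a boundary. -/
def AcyclicAt (K : PreAbstractSimplicialComplex α) (i : ℤ) : Prop :=
  K.augCycles i ≤ K.augBoundaries i

theorem subsingleton_reducedHomology_iff (K : PreAbstractSimplicialComplex α) (i : ℤ) :
    Subsingleton (K.ReducedHomology i) ↔ K.AcyclicAt i := by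
  rw [ReducedHomology, Submodule.Quotient.subsingleton_iff, Submodule.submoduleOf_eq_top]
  rfl

theorem acyclicAt_of_lt (K : PreAbstractSimplicialComplex α) {i : ℤ} (hi : i < -1) :
    K.AcyclicAt i := by
  rintro c ⟨hc, -⟩
  have : c = 0 := by
    ext σ
    by_contra h
    have := ((K.mem_augChains_iff).1 hc σ h).2
    omega
  rw [this]
  exact Submodule.zero_mem _

/-- The supremum is attained: a degree with nonzero homology bounds the set above, and -2 belongs to
it vacuously. This replaces values of `connH` by thresholds. -/
theorem coe_le_connH_iff (K : PreAbstractSimplicialComplex α) (k : ℤ) :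
    (k : WithTop ℤ) ≤ K.connH ↔ ∀ i ≤ k, K.AcyclicAt i := by
  unfold connH
  split_ifs with h <;> simp only [subsingleton_reducedHomology_iff] at h ⊢
  · exact ⟨fun _ i _ => h i, fun _ => le_top⟩
  · rw [WithTop.coe_le_coe]
    obtain ⟨j, hj⟩ := not_forall.1 h
    have hj1 : -1 ≤ j := by
      by_contra hlt
      exact hj (K.acyclicAt_of_lt (not_le.1 hlt))
    set S : Set ℤ := {k : ℤ | ∀ i : ℤ, -1 ≤ i → i ≤ k → K.AcyclicAt i} with hS
    have hbdd : BddAbove S := ⟨j, fun k hk => by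
      by_contra hlt
      exact hj (hk j hj1 (not_le.1 hlt).le)⟩
    have hne : S.Nonempty := ⟨-2, fun i h1 h2 => by omega⟩
    constructor
    · intro hk i hi
      by_cases h1 : -1 ≤ i
      · exact Int.csSup_mem hne hbdd i h1 (hi.trans hk)
      · exact K.acyclicAt_of_lt (not_le.1 h1)
    · exact fun hk => le_csSup hbdd fun i _ hi => hk i hi

/-! ### The chain map onto the link of F -/

/-- The sign of a vertex `v` relative to `F`. -/
def relSign (F : Finset α) (v : α) : ℤ := (-1) ^ (F.filter fun u => u < v).card

theorem relSign_mul_self (F : Finset α) (v : α) : relSign F v * relSign F v = 1 := by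
  rw [relSign, ← mul_pow]; simp

/-- The sign of the shuffle that moves the vertices of `F` in front of those of `τ`. -/
def shuffleSign (F τ : Finset α) : ℤ := ∏ v ∈ τ, relSign F v

theorem shuffleSign_mul_self (F τ : Finset α) : shuffleSign F τ * shuffleSign F τ = 1 := by
  rw [shuffleSign, ← Finset.prod_mul_distrib]
  exact Finset.prod_eq_one fun v _ => relSign_mul_self F v

theorem relSign_mul_shuffleSign_erase (F : Finset α) {τ : Finset α} {v : α} (hv : v ∈ τ) :
    relSign F v * shuffleSign F (τ.erase v) = shuffleSign F τ :=
  Finset.mul_prod_erase τ (relSign F) hv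

/-- The chain map that sends a simplex `σ` containing `F` to `± (σ \ F)`, and any other simplex
to `0`. -/
noncomputable def linkMap (F : Finset α) : (Finset α →₀ ℤ) →ₗ[ℤ] (Finset α →₀ ℤ) :=
  Finsupp.linearCombination ℤ fun σ : Finset α =>
    if F ⊆ σ then Finsupp.single (σ \ F) (shuffleSign F (σ \ F)) else 0

theorem linkMap_single (F σ : Finset α) (n : ℤ) :
    linkMap F (Finsupp.single σ n) =
      n • if F ⊆ σ then Finsupp.single (σ \ F) (shuffleSign F (σ \ F)) else 0 := by
  simp only [linkMap, Finsupp.linearCombination_single]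

theorem neg_one_pow_card_filter_lt (F : Finset α) {σ : Finset α} (hF : F ⊆ σ) (v : α) :
    (-1 : ℤ) ^ (σ.filter fun u => u < v).card =
      (-1) ^ ((σ \ F).filter fun u => u < v).card * relSign F v := by
  rw [relSign, ← pow_add, ← Finset.card_union_of_disjoint, ← Finset.filter_union,
    Finset.sdiff_union_of_subset hF]
  exact Finset.disjoint_filter_filter Finset.sdiff_disjoint

/-- Deleting a vertex of F destroys the inclusion of F, so only vertices v outside F contribute. For
these the boundary signs in σ and in σ \ F differ by `relSign F v`, which is exactly the factor lost
from `shuffleSign` when v is erased. -/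
theorem linkMap_boundary (F : Finset α) (c : Finset α →₀ ℤ) :
    linkMap F (boundary α c) = boundary α (linkMap F c) := by
  induction c using Finsupp.induction_linear with
  | zero => simp
  | add f g hf hg => simp only [map_add, hf, hg]
  | single σ n =>
    rw [boundary_single, linkMap_single, map_smul, map_smul, map_sum]
    congr 1
    simp only [linkMap_single]
    split_ifs with hF
    · rw [boundary_single, ← Finset.sum_sdiff hF, Finset.smul_sum]
      have h0 : ∑ v ∈ F, ((-1 : ℤ) ^ (σ.filter fun u => u < v).card •
          if F ⊆ σ.erase v then
            Finsupp.single (σ.erase v \ F) (shuffleSign F (σ.erase v \ F)) else 0) = 0 := by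
        refine Finset.sum_eq_zero fun v hv => ?_
        rw [if_neg, smul_zero]
        exact fun h => Finset.notMem_erase v σ (h hv)
      rw [h0, add_zero]
      refine Finset.sum_congr rfl fun v hv => ?_
      have hvF := (Finset.mem_sdiff.1 hv).2
      rw [if_pos (Finset.subset_erase.2 ⟨hF, hvF⟩), Finset.erase_sdiff_comm,
        Finsupp.smul_single, Finsupp.smul_single, neg_one_pow_card_filter_lt F hF v,
        ← relSign_mul_shuffleSign_erase F hv, smul_eq_mul, smul_eq_mul]
      congr 1
      have := relSign_mul_self F v
      ring
    · rw [map_zero]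
      refine Finset.sum_eq_zero fun v _ => ?_
      rw [if_neg, smul_zero]
      exact fun h => hF (h.trans (Finset.erase_subset v σ))

theorem linkMap_apply (F : Finset α) (c : Finset α →₀ ℤ) (τ : Finset α) :
    linkMap F c τ = if Disjoint τ F then shuffleSign F τ * c (τ ∪ F) else 0 := by
  induction c using Finsupp.induction_linear with
  | zero => simp
  | add f g hf hg =>
    rw [map_add, Finsupp.add_apply, hf, hg, Finsupp.add_apply]
    split_ifs <;> ring
  | single σ n =>
    rw [linkMap_single]
    split_ifs with h1 h2 h2
    · rw [Finsupp.smul_single, Finsupp.single_apply, Finsupp.single_apply]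
      by_cases h : σ = τ ∪ F
      · subst h
        rw [if_pos, if_pos rfl, Finset.union_sdiff_cancel_right h2, smul_eq_mul, mul_comm]
        exact Finset.union_sdiff_cancel_right h2
      · rw [if_neg, if_neg h, mul_zero]
        rintro rfl
        exact h (Finset.sdiff_union_of_subset h1).symm
    · rw [Finsupp.smul_single, Finsupp.single_apply, if_neg]
      rintro rfl
      exact h2 Finset.sdiff_disjoint
    · rw [Finsupp.single_apply, if_neg]
      · simp
      · rintro rfl
        exact h1 Finset.subset_union_right
    · simp

/-! ### The exact sequence of a star extension -/

/-- `K'` arises from its subcomplex `K` by adding the simplices that contain `F`, and `L` is the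
link of `F` in `K'`. The empty simplex is counted as a face. -/
structure IsStarExtension (F : Finset α) (K K' L : PreAbstractSimplicialComplex α) : Prop where
  face_iff : ∀ σ, (σ = ∅ ∨ σ ∈ K.faces) ↔ (σ = ∅ ∨ σ ∈ K'.faces) ∧ ¬ F ⊆ σ
  link_iff : ∀ τ, (τ = ∅ ∨ τ ∈ L.faces) ↔ Disjoint τ F ∧ (τ ∪ F = ∅ ∨ τ ∪ F ∈ K'.faces)

namespace IsStarExtension

variable {F : Finset α} {K K' L : PreAbstractSimplicialComplex α}

theorem augChains_le (h : IsStarExtension F K K' L) (i : ℤ) :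
    K.augChains i ≤ K'.augChains i := fun c hc => by
  rw [mem_augChains_iff] at hc ⊢
  exact fun σ hσ => ⟨((h.face_iff σ).1 (hc σ hσ).1).1, (hc σ hσ).2⟩

/-- With `mem_of_linkMap_eq_zero` and `exists_linkMap_eq`, this is the short exact sequence of
chains 0 → K → K' → L → 0, the last map lowering degree by |F|. -/
theorem linkMap_eq_zero (h : IsStarExtension F K K' L) {i : ℤ} {c : Finset α →₀ ℤ}
    (hc : c ∈ K.augChains i) : linkMap F c = 0 := by
  rw [mem_augChains_iff] at hc
  ext τ
  rw [linkMap_apply, Finsupp.zero_apply]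
  split_ifs with hd
  · by_contra hne
    exact ((h.face_iff _).1 (hc _ (right_ne_zero_of_mul hne)).1).2 Finset.subset_union_right
  · rfl

theorem mem_of_linkMap_eq_zero (h : IsStarExtension F K K' L) {i : ℤ} {c : Finset α →₀ ℤ}
    (hc : c ∈ K'.augChains i) (h0 : linkMap F c = 0) : c ∈ K.augChains i := by
  rw [mem_augChains_iff] at hc ⊢
  refine fun σ hσ => ⟨(h.face_iff σ).2 ⟨(hc σ hσ).1, fun hF => hσ ?_⟩, (hc σ hσ).2⟩
  have := DFunLike.congr_fun h0 (σ \ F)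
  rw [linkMap_apply, if_pos Finset.sdiff_disjoint, Finset.sdiff_union_of_subset hF,
    Finsupp.zero_apply] at this
  rw [← one_mul (c σ), ← shuffleSign_mul_self F (σ \ F), mul_assoc, this, mul_zero]

theorem linkMap_mem (h : IsStarExtension F K K' L) {i : ℤ} {c : Finset α →₀ ℤ}
    (hc : c ∈ K'.augChains i) : linkMap F c ∈ L.augChains (i - F.card) := by
  rw [mem_augChains_iff] at hc ⊢
  intro τ hτ
  rw [linkMap_apply] at hτ
  split_ifs at hτ with hd
  · obtain ⟨h1, h2⟩ := hc _ (right_ne_zero_of_mul hτ)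
    refine ⟨(h.link_iff τ).2 ⟨hd, h1⟩, ?_⟩
    rw [Finset.card_union_of_disjoint hd] at h2
    push_cast at h2
    omega
  · exact absurd rfl hτ

theorem exists_linkMap_eq (h : IsStarExtension F K K' L) {i : ℤ} {c : Finset α →₀ ℤ}
    (hc : c ∈ L.augChains (i - F.card)) : ∃ d ∈ K'.augChains i, linkMap F d = c := by
  rw [← Submodule.mem_map]
  rw [← Finsupp.sum_single c]
  refine Submodule.sum_mem _ fun τ hτ => ?_
  obtain ⟨h1, h2⟩ := (L.mem_augChains_iff).1 hc τ (Finsupp.mem_support_iff.1 hτ)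
  obtain ⟨hd, h3⟩ := (h.link_iff τ).1 h1
  refine ⟨Finsupp.single (τ ∪ F) (c τ * shuffleSign F τ),
    Finsupp.single_mem_supported ℤ _ ⟨h3, ?_⟩, ?_⟩
  · rw [Finset.card_union_of_disjoint hd]
    push_cast
    omega
  · rw [linkMap_single, if_pos Finset.subset_union_right, Finset.union_sdiff_cancel_right hd,
      Finsupp.smul_single, smul_eq_mul, mul_assoc, shuffleSign_mul_self, mul_one]

/-- Exactness of `H_{i+1-|F|}(L) → H_i(K) → H_i(K')`. -/
theorem acyclicAt (h : IsStarExtension F K K' L) {i : ℤ} (h' : K'.AcyclicAt i)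
    (hL : L.AcyclicAt (i + 1 - F.card)) : K.AcyclicAt i := by
  rintro z ⟨hz, hz0⟩
  obtain ⟨c, hc, rfl⟩ := h' ⟨h.augChains_le i hz, hz0⟩
  obtain ⟨e, he, hec⟩ := hL ⟨h.linkMap_mem hc, LinearMap.mem_ker.2 (by
    rw [← linkMap_boundary, h.linkMap_eq_zero hz])⟩
  rw [sub_add_eq_add_sub] at he
  obtain ⟨d, hd, rfl⟩ := h.exists_linkMap_eq he
  -- Subtracting ∂d removes the simplices containing F from the filling c without changing its
  -- boundary z.
  refine ⟨c - boundary α d, h.mem_of_linkMap_eq_zero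
    (Submodule.sub_mem _ hc (K'.boundary_mem_augChains hd)) ?_, ?_⟩
  · rw [map_sub, linkMap_boundary, hec, sub_self]
  · rw [map_sub, boundary_boundary, sub_zero]

/-- Exactness of `H_i(K) → H_i(K') → H_{i-|F|}(L)`. -/
theorem acyclicAt_extension (h : IsStarExtension F K K' L) {i : ℤ} (hK : K.AcyclicAt i)
    (hL : L.AcyclicAt (i - F.card)) : K'.AcyclicAt i := by
  rintro z ⟨hz, hz0⟩
  obtain ⟨e, he, hez⟩ := hL ⟨h.linkMap_mem hz, LinearMap.mem_ker.2 (by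
    rw [← linkMap_boundary, LinearMap.mem_ker.1 hz0, map_zero])⟩
  rw [sub_add_eq_add_sub] at he
  obtain ⟨d, hd, rfl⟩ := h.exists_linkMap_eq he
  obtain ⟨f, hf, hfz⟩ := hK (x := z - boundary α d) ⟨h.mem_of_linkMap_eq_zero
    (Submodule.sub_mem _ hz (K'.boundary_mem_augChains hd))
    (by rw [map_sub, linkMap_boundary, hez, sub_self]), LinearMap.mem_ker.2 (by
      rw [map_sub, boundary_boundary, LinearMap.mem_ker.1 hz0, sub_zero])⟩
  refine ⟨f + d, Submodule.add_mem _ (h.augChains_le _ hf) hd, ?_⟩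
  rw [map_add, hfz, sub_add_cancel]

end IsStarExtension

/-! ### Cones, and the two edgeless cases -/

/-- The cone operator with apex `a`. -/
noncomputable def coneMap (a : α) : (Finset α →₀ ℤ) →ₗ[ℤ] (Finset α →₀ ℤ) :=
  Finsupp.linearCombination ℤ fun σ : Finset α =>
    if a ∈ σ then 0 else Finsupp.single (insert a σ) 1

theorem coneMap_single (a : α) (σ : Finset α) (n : ℤ) :
    coneMap a (Finsupp.single σ n) =
      n • if a ∈ σ then 0 else Finsupp.single (insert a σ) 1 := by
  simp only [coneMap, Finsupp.linearCombination_single]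

/-- As the apex precedes every vertex of σ, coning needs no sign, and inserting it flips the sign of
every other face; the remaining terms cancel in pairs. -/
theorem boundary_coneMap_single (a : α) (σ : Finset α) (n : ℤ) (ha : ∀ v ∈ σ, a ≤ v) :
    boundary α (coneMap a (Finsupp.single σ n)) + coneMap a (boundary α (Finsupp.single σ n)) =
      Finsupp.single σ n := by
  have hempty : (σ.filter fun u => u < a) = ∅ :=
    Finset.filter_eq_empty_iff.2 fun u hu => not_lt.2 (ha u hu)
  rw [boundary_single, coneMap_single, map_smul, map_smul, map_sum, ← smul_add]
  simp only [coneMap_single]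
  suffices h : ∀ x : Finset α →₀ ℤ, x = Finsupp.single σ 1 → n • x = Finsupp.single σ n by
    apply h
    split_ifs with has
    · rw [map_zero, zero_add, Finset.sum_eq_single_of_mem a has]
      · rw [if_neg (Finset.notMem_erase a σ), Finset.insert_erase has, hempty]
        simp
      · intro v _ hva
        rw [if_pos (Finset.mem_erase.2 ⟨hva.symm, has⟩), smul_zero]
    · rw [boundary_single, one_smul, Finset.sum_insert has, Finset.erase_insert has, add_assoc,
        ← Finset.sum_add_distrib, Finset.sum_eq_zero, add_zero, Finset.filter_insert,
        if_neg (lt_irrefl a), hempty]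
      · simp
      · intro v hv
        have hav : a ≠ v := fun h => has (h ▸ hv)
        rw [if_neg fun h => has (Finset.mem_of_mem_erase h), Finset.filter_insert,
          if_pos (lt_of_le_of_ne (ha v hv) hav), Finset.card_insert_of_notMem
          (fun h => has (Finset.mem_of_mem_filter _ h)), Finset.erase_insert_of_ne hav,
          Finsupp.smul_single, smul_eq_mul, mul_one, pow_succ, ← Finsupp.single_add]
        simp
  rintro x rfl
  simp

/-- A full simplex is acyclic. -/
theorem acyclicAt_of_simplex (K : PreAbstractSimplicialComplex α) {V : Finset α}
    (hV : V.Nonempty) (hK : ∀ σ, (σ = ∅ ∨ σ ∈ K.faces) ↔ σ ⊆ V) (i : ℤ) : K.AcyclicAt i := by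
  rintro z ⟨hz, hz0⟩
  -- Coning from the least vertex of V is a contracting homotopy.
  have key : ∀ c ∈ K.augChains i, coneMap (V.min' hV) c ∈ K.augChains (i + 1) ∧
      boundary α (coneMap (V.min' hV) c) + coneMap (V.min' hV) (boundary α c) = c := by
    intro c hc
    have hsum := Finsupp.sum_single c
    rw [mem_augChains_iff] at hc
    constructor
    · rw [coneMap, Finsupp.linearCombination_apply]
      refine Submodule.sum_mem _ fun σ hσ => Submodule.smul_mem _ _ ?_
      obtain ⟨h1, h2⟩ := hc σ (Finsupp.mem_support_iff.1 hσ)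
      split_ifs with has
      · exact Submodule.zero_mem _
      · refine Finsupp.single_mem_supported ℤ _ ⟨(hK _).2 ?_, ?_⟩
        · exact Finset.insert_subset (V.min'_mem hV) ((hK σ).1 h1)
        · rw [Finset.card_insert_of_notMem has]
          push_cast
          omega
    · conv_rhs => rw [← hsum]
      conv_lhs => rw [← hsum]
      simp only [Finsupp.sum, map_sum]
      rw [← Finset.sum_add_distrib]
      refine Finset.sum_congr rfl fun σ hσ => boundary_coneMap_single _ _ _ fun v hv => ?_
      exact V.min'_le v ((hK σ).1 (hc σ (Finsupp.mem_support_iff.1 hσ)).1 hv)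
  obtain ⟨h1, h2⟩ := key z hz
  rw [LinearMap.mem_ker.1 hz0, map_zero, add_zero] at h2
  exact ⟨_, h1, h2⟩

/-- The complex without vertices has nonzero homology in degree `-1`. -/
theorem not_acyclicAt_neg_one (K : PreAbstractSimplicialComplex α) (hK : K.faces = ∅) :
    ¬ K.AcyclicAt (-1) := by
  intro h
  obtain ⟨c, hc, hc1⟩ := h (x := Finsupp.single ∅ 1)
    ⟨Finsupp.single_mem_supported ℤ _ (by simp), LinearMap.mem_ker.2 (by
      rw [boundary_single]; simp)⟩
  have hc0 : c = 0 := by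
    ext σ
    by_contra hne
    obtain ⟨h1, h2⟩ := (K.mem_augChains_iff).1 hc σ hne
    rcases h1 with rfl | h1
    · simp at h2
    · rw [hK] at h1
      exact h1
  rw [hc0, map_zero] at hc1
  exact one_ne_zero (Finsupp.single_eq_zero.1 hc1.symm)

end PreAbstractSimplicialComplex

/-! ### Independence complexes and the links of edges -/

namespace SimpleHypergraph

open PreAbstractSimplicialComplex

theorem empty_or_mem_Ind_iff {α : Type*} (C : SimpleHypergraph α) (σ : Finset α) :
    (σ = ∅ ∨ σ ∈ C.Ind.faces) ↔ σ ⊆ C.verts ∧ ∀ E ∈ C.edges, ¬ E ⊆ σ := by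
  constructor
  · rintro (rfl | h)
    · refine ⟨Finset.empty_subset _, fun E hE h => ?_⟩
      have := C.two_le_card E hE
      rw [Finset.subset_empty.1 h] at this
      simp at this
    · exact h.2
  · intro h
    rcases σ.eq_empty_or_nonempty with h0 | h0
    · exact Or.inl h0
    · exact Or.inr ⟨h0, h⟩

theorem verts_nonempty {α : Type*} (C : SimpleHypergraph α) {F : Finset α} (hF : F ∈ C.edges) :
    C.verts.Nonempty := by
  have h : 0 < F.card := lt_of_lt_of_le two_pos (C.two_le_card F hF)
  exact (Finset.card_pos.1 h).mono (C.subset_verts F hF)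

section Link

variable {α : Type*} [DecidableEq α]

/-- The faces of `Ind(C : F)` form the link of `F` in `Ind(C - F)`. -/
theorem colon_face_iff (C : SimpleHypergraph α) {F : Finset α} (hF : F ∈ C.edges)
    (τ : Finset α) :
    (τ ⊆ (C.colon F).verts ∧ ∀ E ∈ (C.colon F).edges, ¬ E ⊆ τ) ↔
      Disjoint τ F ∧ τ ∪ F ⊆ C.verts ∧ ∀ E ∈ (C.deleteEdge F).edges, ¬ E ⊆ τ ∪ F := by
  have hverts : (C.colon F).verts = C.verts \ (F ∪ C.edgeNeighbours F) := rfl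
  have hsub : ∀ E : Finset α, E ⊆ τ ∪ F ↔ E \ F ⊆ τ := fun E => sdiff_le_iff'.symm
  simp only [hsub]
  constructor
  · rintro ⟨hτ, hE⟩
    rw [hverts, Finset.subset_sdiff, Finset.disjoint_union_right] at hτ
    obtain ⟨hτV, hτF, hτN⟩ := hτ
    refine ⟨hτF, Finset.union_subset hτV (C.subset_verts F hF), fun E hEC hEτ => ?_⟩
    -- A minimal trace below E \ F is nonempty by incomparability, so it is either a single
    -- neighbour of F, which is not a vertex of C : F, or an edge of C : F.
    obtain ⟨T, hTE, hT⟩ := Finset.exists_le_minimal (C.traces F)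
      (Finset.mem_image_of_mem (fun E => E \ F) hEC)
    obtain ⟨E', hE', rfl⟩ := Finset.mem_image.1 hT.prop
    obtain ⟨hne, hE'C⟩ := Finset.mem_erase.1 hE'
    have hTτ : E' \ F ⊆ τ := Finset.Subset.trans hTE hEτ
    rcases Nat.lt_or_ge (E' \ F).card 2 with h2 | h2
    · have h0 : (E' \ F).card ≠ 0 := fun h0 =>
        hne (C.incomparable E' hE'C F hF (Finset.sdiff_eq_empty_iff_subset.1
          (Finset.card_eq_zero.1 h0)))
      have h1 : (E' \ F).card = 1 := by omega
      obtain ⟨x, hx⟩ := Finset.card_eq_one.1 h1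
      have hxE : x ∈ E' \ F := hx ▸ Finset.mem_singleton_self x
      exact Finset.disjoint_left.1 hτN (hTτ hxE)
        (Finset.mem_biUnion.2 ⟨E', Finset.mem_filter.2 ⟨hE'C, h1⟩, hxE⟩)
    · exact hE _ (Finset.mem_filter.2 ⟨hT.prop, h2, fun T' hT' h =>
        Finset.Subset.antisymm h (hT.le_of_le hT' h)⟩) hTτ
  · rintro ⟨hτF, hτV, hE⟩
    refine ⟨?_, fun S hS hSτ => ?_⟩
    · rw [hverts, Finset.subset_sdiff, Finset.disjoint_union_right]
      refine ⟨Finset.union_subset_left hτV, hτF, Finset.disjoint_left.2 fun x hx hxN => ?_⟩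
      obtain ⟨E, hEC, hxE⟩ := Finset.mem_biUnion.1 hxN
      obtain ⟨hEC, h1⟩ := Finset.mem_filter.1 hEC
      obtain ⟨y, hy⟩ := Finset.card_eq_one.1 h1
      refine hE E (Finset.mem_erase.2 ⟨?_, hEC⟩) ?_
      · rintro rfl
        simp at h1
      · rw [hy] at hxE ⊢
        rw [← Finset.mem_singleton.1 hxE]
        exact Finset.singleton_subset_iff.2 hx
    · obtain ⟨E, hEC, rfl⟩ := Finset.mem_image.1 (Finset.mem_filter.1 hS).1
      exact hE E hEC hSτ

end Link

variable {α : Type*} [LinearOrder α]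

theorem isStarExtension_Ind (C : SimpleHypergraph α) {F : Finset α} (hF : F ∈ C.edges) :
    IsStarExtension F C.Ind (C.deleteEdge F).Ind (C.colon F).Ind where
  face_iff σ := by
    rw [empty_or_mem_Ind_iff, empty_or_mem_Ind_iff, and_assoc]
    refine and_congr_right fun _ => ⟨fun h => ⟨fun E hE => h E (Finset.mem_of_mem_erase hE),
      h F hF⟩, fun h E hE => ?_⟩
    by_cases hEF : E = F
    · exact hEF ▸ h.2
    · exact h.1 E (Finset.mem_erase.2 ⟨hEF, hE⟩)
  link_iff τ := by
    rw [empty_or_mem_Ind_iff, empty_or_mem_Ind_iff, colon_face_iff C hF]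
    rfl

theorem acyclicAt_Ind_of_edges_eq_empty (C : SimpleHypergraph α) (hV : C.verts.Nonempty)
    (hC : C.edges = ∅) (i : ℤ) : C.Ind.AcyclicAt i := by
  refine acyclicAt_of_simplex _ hV (fun σ => ?_) i
  rw [empty_or_mem_Ind_iff, hC]
  simp

/-! ### Comparing ψ with connectivity -/

/-- A positive n lies below a finite supremum only if it lies below some term. For n = 0 no edge
would be produced, since 0 is the bottom element. -/
theorem natCast_le_psi_iff (C : SimpleHypergraph α) (hC : C.edges.Nonempty) {n : ℕ}
    (hn : n ≠ 0) : (n : ℕ∞) ≤ C.psi ↔ ∃ F ∈ C.edges, (n : ℕ∞) ≤ (C.deleteEdge F).psi ∧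
      ((n - (F.card - 1) : ℕ) : ℕ∞) ≤ (C.colon F).psi := by
  obtain ⟨E, hE⟩ := hC
  rw [psi, if_neg (C.verts_nonempty hE).ne_empty, if_neg (Finset.ne_empty_of_mem hE),
    Finset.le_sup_iff (by rw [bot_eq_zero]; exact_mod_cast Nat.pos_of_ne_zero hn)]
  simp only [Finset.mem_attach, true_and, Subtype.exists, le_min_iff, ENat.natCast_sub,
    tsub_le_iff_right, exists_prop]

/-- `ψ(C) ≤ conn_h(Ind(C)) + 2` for every hypergraph. -/
theorem acyclicAt_of_le_psi (C : SimpleHypergraph α) (n : ℕ) (hn : (n : ℕ∞) ≤ C.psi) (i : ℤ)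
    (hi : i + 2 ≤ n) : C.Ind.AcyclicAt i := by
  rcases Nat.eq_zero_or_pos n with rfl | hpos
  · exact acyclicAt_of_lt _ (by push_cast at hi; omega)
  rcases C.edges.eq_empty_or_nonempty with h0 | h0
  · rcases C.verts.eq_empty_or_nonempty with hV | hV
    · rw [psi, if_pos hV] at hn
      have : n ≤ 0 := by exact_mod_cast hn
      omega
    · exact C.acyclicAt_Ind_of_edges_eq_empty hV h0 i
  · obtain ⟨F, hF, h1, h2⟩ := (C.natCast_le_psi_iff h0 hpos.ne').1 hn
    have hcard := C.two_le_card F hF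
    exact (C.isStarExtension_Ind hF).acyclicAt
      (acyclicAt_of_le_psi (C.deleteEdge F) n h1 i hi)
      (acyclicAt_of_le_psi (C.colon F) _ h2 _ (by omega))
termination_by C.edges.card
decreasing_by
  · exact C.card_edges_deleteEdge_lt hF
  · exact C.card_edges_colon_lt hF

/-- `conn_h(Ind(C)) + 2 ≤ ψ(C)` for every properly-splitted hypergraph. -/
theorem IsProperlySplitted.le_psi {C : SimpleHypergraph α} (hC : C.IsProperlySplitted) (n : ℕ)
    (hn : ((n - 2 : ℤ) : WithTop ℤ) ≤ C.Ind.connH) : (n : ℕ∞) ≤ C.psi := by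
  induction hC generalizing n with
  | of_edges_eq_empty C h =>
    rw [psi, if_pos h]
    split_ifs with hV
    · rw [coe_le_connH_iff] at hn
      by_contra hpos
      have hpos : n ≠ 0 := by rintro rfl; simp at hpos
      refine not_acyclicAt_neg_one C.Ind (Set.eq_empty_of_forall_notMem fun σ hσ => ?_)
        (hn (-1) (by omega))
      obtain ⟨x, hx⟩ := hσ.1
      have := hσ.2.1 hx
      rw [hV] at this
      exact Finset.notMem_empty x this
    · exact le_top
  | of_edge C F hF hconn _ _ ihd ihc =>
    rcases Nat.eq_zero_or_pos n with rfl | hpos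
    · exact zero_le
    have hcard := C.two_le_card F hF
    have hcolon : ((n - 2 + (-(F.card : ℤ) + 1) : ℤ) : WithTop ℤ) ≤ (C.colon F).Ind.connH := by
      rw [WithTop.coe_add]
      exact (add_le_add_left hn _).trans hconn
    rw [coe_le_connH_iff] at hn hcolon
    -- The splitting edge is the witness.
    refine (C.natCast_le_psi_iff ⟨F, hF⟩ hpos.ne').2 ⟨F, hF, ihd n ?_, ihc _ ?_⟩
    · rw [coe_le_connH_iff]
      exact fun i hi => (C.isStarExtension_Ind hF).acyclicAt_extension (hn i hi)
        (hcolon _ (by omega))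
    · rw [coe_le_connH_iff]
      intro i hi
      -- The second case arises only when the subtraction n - (|F| - 1) truncates to 0; then i ≤ -2,
      -- where homology vanishes trivially.
      by_cases h : i ≤ n - 2 + (-(F.card : ℤ) + 1)
      · exact hcolon i h
      · exact acyclicAt_of_lt _ (by omega)

theorem IsProperlySplitted.le_psi_iff {C : SimpleHypergraph α} (hC : C.IsProperlySplitted)
    (n : ℕ) : (n : ℕ∞) ≤ C.psi ↔ ((n - 2 : ℤ) : WithTop ℤ) ≤ C.Ind.connH :=
  ⟨fun h => (coe_le_connH_iff _ _).2 fun i hi => C.acyclicAt_of_le_psi n h i (by omega),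
    hC.le_psi n⟩

end SimpleHypergraph

theorem mainTheorem6 {α : Type*} [LinearOrder α] (C : SimpleHypergraph α)
    (hC : C.IsProperlySplitted) :
    ENat.map (Nat.cast : ℕ → ℤ) C.psi = C.Ind.connH + 2 := by
  have key := hC.le_psi_iff
  generalize C.psi = p at key
  generalize C.Ind.connH = q at key
  have h2 : (2 : WithTop ℤ) = ((2 : ℤ) : WithTop ℤ) := rfl
  cases p with
  | top =>
    cases q with
    | top => rfl
    | coe b =>
      -- The threshold n = b + 3 (or 0 if this is negative) has n - 2 > b, contradicting conn_h = b.
      have := WithTop.coe_le_coe.1 ((key (b + 3).toNat).1 le_top)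
      omega
  | coe m =>
    have hm := (key m).1 le_rfl
    -- The threshold holds at m and fails at m + 1, which pins conn_h to m - 2.
    have hm1 := (key (m + 1)).not.1 (by
      rw [not_le]
      exact_mod_cast Nat.lt_succ_self m)
    cases q with
    | top => exact absurd le_top hm1
    | coe b =>
      rw [WithTop.coe_le_coe] at hm hm1
      push_cast at hm1
      rw [ENat.map_natCast, h2, ← WithTop.coe_add]
      congr 1
      omega
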